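/- Let $k$ be a field and let $\mathcal{C}$ be a modular category over $k$: a $k$-linear additive monoidal category (with $k$-bilinear tensor product of morphisms) which is a fusion category, i.e. every object has a dual, all Hom spaces are finite-dimensional, every object is isomorphic to a finite biproduct of simple objects (objects $X$ with $\operatorname{End}(X)\cong k$), there are only finitely many simple objects up to isomorphism, and the unit $\mathbf 1$ is simple; which carries a braiding $\sigma$ and a ribbon twist $\nu$; and whose $S$-matrix is non-degenerate. Here, for $f\colon X\to X$, $$\operatorname{tr}_X(f)=\operatorname{ev}_X\circ\sigma_{X,X^*}\circ(\nu_X\otimes \mathrm{id}_{X^*})\circ(f\otimes\mathrm{id}_{X^*})\circ\operatorname{coev}_X\in\operatorname{End}(\mathbf 1)\cong k,\qquad \dim X=\operatorname{tr}_X(\mathrm{id}_X),$$ and $S_{ij}=\operatorname{tr}_{V_i\otimes V_j}(\sigma_{V_j,V_i}\circ\sigma_{V_i,V_j})$, where $\{V_j\}_{j\in I}$ is a family of representatives of the isomorphism classes of simple objects. For an object $V\cong\bigoplus_{j\in I}m_jV_j$ with multiplicities $m_j\in\mathbb{N}_0$ and for coefficients $c_j\in k$, $j\in I$, put $$\alpha=\sum_{j\in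 I}c_j\,m_j\,\nu_j^{-1}\dim V_j,\qquad \beta=\sum_{j\in I}c_j\,m_j\,\nu_j\dim V_j,$$ where $\nu_j\in k$ is the scalar by which the ribbon twist acts on $V_j$. If $V=\hat V:=\bigoplus_{j\in I}V_j$ and $c_j=\dim V_j$ for all $j\in I$, then $\alpha\neq 0$ and $\beta\neq 0$. -/

import Mathlib

open CategoryTheory MonoidalCategory Limits

universe w v u

namespace RT

section Ribbon

variable (C : Type u) [Category.{v} C] [MonoidalCategory C] [BraidedCategory C]
  [RightRigidCategory C]

/-- A ribbon structure on a braided monoidal category in which every object `X` has a dual `Xᘁ` with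
`ev : Xᘁ ⊗ X ⟶ 𝟙_ C` and `coev : 𝟙_ C ⟶ X ⊗ Xᘁ` (called a left dual by some authors and a right
dual in Mathlib): a natural automorphism `ν` of the identity functor with
`ν_{X ⊗ Y} = σ_{Y,X} ∘ σ_{X,Y} ∘ (ν_X ⊗ ν_Y)` and
`(ν_X ⊗ id) ∘ coev_X = (id ⊗ ν_{X*}) ∘ coev_X`. -/
class RibbonCategory where
  /-- the ribbon twist -/
  twist : ∀ X : C, X ≅ X
  twist_naturality : ∀ {X Y : C} (f : X ⟶ Y), f ≫ (twist Y).hom = (twist X).hom ≫ f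
  twist_tensor : ∀ X Y : C,
    (twist (X ⊗ Y)).hom =
      ((twist X).hom ⊗ₘ (twist Y).hom) ≫ (β_ X Y).hom ≫ (β_ Y X).hom
  twist_coev : ∀ X : C,
    ExactPairing.coevaluation X Xᘁ ≫ (twist X).hom ▷ Xᘁ =
      ExactPairing.coevaluation X Xᘁ ≫ X ◁ (twist Xᘁ).hom

variable {C} [RibbonCategory C]

/-- The right evaluation `X ⊗ X* ⟶ 𝟙` of a ribbon category, `ev_X ∘ σ_{X,X*} ∘ (ν_X ⊗ id)`. -/
def rightEv (X : C) : X ⊗ Xᘁ ⟶ 𝟙_ C :=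
  (RibbonCategory.twist X).hom ▷ Xᘁ ≫ (β_ X Xᘁ).hom ≫ ExactPairing.evaluation X Xᘁ

/-- The (quantum) trace of an endomorphism in a ribbon category, an endomorphism of the unit. -/
def trace {X : C} (f : X ⟶ X) : 𝟙_ C ⟶ 𝟙_ C :=
  ExactPairing.coevaluation X Xᘁ ≫ f ▷ Xᘁ ≫ rightEv X

/-- The double braiding `Q_{X,Y} = σ_{Y,X} ∘ σ_{X,Y}`. -/
def doubleBraiding (X Y : C) : X ⊗ Y ⟶ X ⊗ Y :=
  (β_ X Y).hom ≫ (β_ Y X).hom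

end Ribbon

section Simple

variable (k : Type w) [Field k] {C : Type u} [Category.{v} C] [Preadditive C] [Linear k C]

/-- An object of a `k`-linear category is simple (in the split sense) if `End X ≅ k`. -/
def IsSimpleObj (X : C) : Prop :=
  Nonempty (End X ≃ₐ[k] k)

variable {k}

/-- The scalar by which an endomorphism of a simple object acts. -/
noncomputable def IsSimpleObj.scalar {X : C} (hX : IsSimpleObj k X) (f : X ⟶ X) : k :=
  hX.some (End.of f)

theorem IsSimpleObj.scalar_smul {X : C} (hX : IsSimpleObj k X) (f : X ⟶ X) :
    hX.scalar f • 𝟙 X = f := by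
  have h : algebraMap k (End X) (hX.scalar f) = End.of f := by
    apply hX.some.injective
    rw [AlgEquiv.commutes]
    rfl
  rw [Algebra.algebraMap_eq_smul_one] at h
  exact h

variable (k)

/-- `V : I → C` lists exactly one representative of each isomorphism class of simple objects. -/
structure IsSimpleReps {I : Type*} (V : I → C) : Prop where
  simple : ∀ j, IsSimpleObj k (V j)
  eq_of_iso : ∀ i j, Nonempty (V i ≅ V j) → i = j
  exists_iso : ∀ X : C, IsSimpleObj k X → ∃ j, Nonempty (X ≅ V j)

end Simple

section Fusion

variable (k : Type w) [Field k] (C : Type u) [Category.{v} C] [Preadditive C] [Linear k C]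
  [HasFiniteBiproducts C]

/-- The conditions that make a `k`-linear additive rigid monoidal category multi-fusion:
finite-dimensional Hom spaces, every object is a finite biproduct of simple objects, and there are
only finitely many simple objects up to isomorphism. -/
class IsMultiFusion : Prop where
  hom_finite : ∀ X Y : C, Module.Finite k (X ⟶ Y)
  semisimple : ∀ X : C, ∃ (n : ℕ) (Y : Fin n → C),
    (∀ i, IsSimpleObj k (Y i)) ∧ Nonempty (X ≅ ⨁ Y)
  finite_simples : ∃ (n : ℕ) (Y : Fin n → C),
    ∀ X : C, IsSimpleObj k X → ∃ i, Nonempty (X ≅ Y i)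

/-- A fusion category is a multi-fusion category whose monoidal unit is simple. -/
class IsFusion [MonoidalCategory C] : Prop extends IsMultiFusion k C where
  unit_simple : IsSimpleObj k (𝟙_ C)

end Fusion

section Modular

variable (k : Type w) [Field k] {C : Type u} [Category.{v} C] [MonoidalCategory C]
  [Preadditive C] [Linear k C] [HasFiniteBiproducts C] [BraidedCategory C]
  [RightRigidCategory C] [RibbonCategory C]

/-- The trace in a fusion category with ribbon structure, as an element of `k ≅ End 𝟙`. -/
noncomputable def scalarTrace [IsFusion k C] {X : C} (f : X ⟶ X) : k :=
  (IsFusion.unit_simple (k := k) (C := C)).scalar (trace f)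

/-- The (quantum) dimension of an object. -/
noncomputable def dim [IsFusion k C] (X : C) : k :=
  scalarTrace k (𝟙 X)

/-- The `S`-matrix: evaluations `tr (Q_{V_i,V_j})` of the Hopf link. -/
noncomputable def sMatrix [IsFusion k C] {I : Type*} (V : I → C) : Matrix I I k :=
  Matrix.of fun i j => scalarTrace k (doubleBraiding (V i) (V j))

variable (C)

/-- A modular category is a fusion category with a ribbon structure and non-degenerate `S`-matrix.
(Representatives of the simple objects indexed by some `Fin n` exist by `finite_simples`; the
condition does not depend on which ones are taken.) -/
class IsModular : Prop extends IsFusion k C where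
  nondegenerate : ∀ (n : ℕ) (V : Fin n → C), IsSimpleReps k V → (sMatrix k V).det ≠ 0

variable {C} {k}

/-- The eigenvalue of the ribbon twist on a simple object. -/
noncomputable def twistEigenvalue {X : C} (hX : IsSimpleObj k X) : k :=
  hX.scalar (RibbonCategory.twist X).hom

/-- The constant `α = ∑_j c_j m_j ν_j⁻¹ dim V_j`. -/
noncomputable def alpha [IsFusion k C] {I : Type*} [Fintype I] {V : I → C}
    (hV : IsSimpleReps k V) (c : I → k) (m : I → ℕ) : k :=
  ∑ j, c j * (m j : k) * (twistEigenvalue (hV.simple j))⁻¹ * dim k (V j)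

/-- The constant `β = ∑_j c_j m_j ν_j dim V_j`. -/
noncomputable def beta [IsFusion k C] {I : Type*} [Fintype I] {V : I → C}
    (hV : IsSimpleReps k V) (c : I → k) (m : I → ℕ) : k :=
  ∑ j, c j * (m j : k) * twistEigenvalue (hV.simple j) * dim k (V j)

end Modular

end RT

/-! Write `d`, `θ` for dimensions and twist eigenvalues and `N i j l` for the dimension of Hom(V_i ⊗
V_j, V_l). Taking traces in the ribbon axiom for the twist of V_i ⊗ V_j gives the balancing equation
θ_i θ_j S_ij = ∑_l N_ij^l θ_l d_l, and rigidity gives ∑_l N_li^j d_l = d_i d_j. Together they yield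
θ_i ∑_l θ_l d_l S_li = β d_i (`gaussSum_mul_dim`). If β = 0, the nonzero vector (θ_l d_l) lies in
the left kernel of S.

For α, a loop coloured by V_i around V_l acts by a scalar χ_l(i), with S_li = χ_l(i) d_l and χ_l a
character of the fusion ring (`encircling_tensor`). Hence the vector w_l = θ_l ∑_i S_li d_i
satisfies (wS)_j = β α d_j. If α = 0, then w = 0, so S d = 0 and d = 0, which is absurd.

Simplicity only means End ≅ k in a category not assumed abelian, so Schur's lemma is itself deduced
from the non-degeneracy of S (`IsSimpleReps.hom_eq_zero`). -/

namespace RT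

/-! ### Braid calculus for the double braiding. -/

section Braided

variable {C : Type u} [Category.{v} C] [MonoidalCategory C] [BraidedCategory C]

theorem braiding_comp_whiskerRight_unit {X Y : C} (e : X ⟶ 𝟙_ C) :
    (β_ Y X).hom ≫ e ▷ Y = Y ◁ e ≫ (ρ_ Y).hom ≫ (λ_ Y).inv := by
  rw [← BraidedCategory.braiding_naturality_right, braiding_tensorUnit_right]

/-- The strand `Y` crosses both legs of a cap, so naturality of the braiding slides it off; braiding
with the unit is trivial. -/
theorem braiding_whiskerRight_comp_evaluation (X X' Y : C) [ExactPairing X X'] :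
    (β_ Y X).hom ▷ X' ≫ (β_ (X ⊗ Y) X').hom ⊗≫ ε_ X X' ▷ Y =
      𝟙 _ ⊗≫ Y ◁ ((β_ X X').hom ≫ ε_ X X') ⊗≫ 𝟙 _ := by
  calc
    _ = 𝟙 _ ⊗≫ ((β_ Y (X ⊗ X')).hom ≫ ((β_ X X').hom ≫ ε_ X X') ▷ Y) ⊗≫ 𝟙 _ := by
      rw [BraidedCategory.braiding_tensor_left_hom, BraidedCategory.braiding_tensor_right_hom]
      monoidal
    _ = _ := by
      rw [braiding_comp_whiskerRight_unit]
      monoidal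

theorem doubleBraiding_comp_braiding_comp_evaluation (X X' Y Y' : C) [ExactPairing X X']
    [ExactPairing Y Y'] :
    doubleBraiding X Y ▷ (Y' ⊗ X') ≫ (β_ (X ⊗ Y) (Y' ⊗ X')).hom ≫ ε_ (X ⊗ Y) (Y' ⊗ X') =
      𝟙 _ ⊗≫ X ◁ ((β_ Y Y').hom ≫ ε_ Y Y') ▷ X' ⊗≫ ((β_ X X').hom ≫ ε_ X X') := by
  calc
    _ = 𝟙 _ ⊗≫ (β_ X Y).hom ▷ Y' ▷ X' ⊗≫ ((β_ Y X).hom ▷ Y' ≫ (β_ (X ⊗ Y) Y').hom) ▷ X' ⊗≫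
          Y' ◁ (β_ (X ⊗ Y) X').hom ⊗≫ Y' ◁ ε_ X X' ▷ Y ⊗≫ ε_ Y Y' := by
      rw [BraidedCategory.braiding_tensor_right_hom (X ⊗ Y), ExactPairing.tensor_evaluation]
      simp only [doubleBraiding]
      monoidal
    _ = 𝟙 _ ⊗≫ (β_ X Y).hom ▷ Y' ▷ X' ⊗≫ (β_ (Y ⊗ X) Y').hom ▷ X' ⊗≫
          Y' ◁ ((β_ Y X).hom ▷ X' ≫ (β_ (X ⊗ Y) X').hom ⊗≫ ε_ X X' ▷ Y) ⊗≫ ε_ Y Y' := by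
      rw [BraidedCategory.braiding_naturality_left]
      monoidal
    _ = 𝟙 _ ⊗≫ ((β_ X Y).hom ▷ Y' ≫ (β_ (Y ⊗ X) Y').hom) ▷ X' ⊗≫
          ((Y' ⊗ Y) ◁ ((β_ X X').hom ≫ ε_ X X') ≫ ε_ Y Y' ▷ 𝟙_ C) ⊗≫ 𝟙 _ := by
      -- The strand `Y` is pulled off the cap of `X`; the second use below pulls `X` off the cap of
      -- `Y`.
      rw [braiding_whiskerRight_comp_evaluation]
      monoidal
    _ = 𝟙 _ ⊗≫ ((β_ X Y).hom ▷ Y' ≫ (β_ (Y ⊗ X) Y').hom ⊗≫ ε_ Y Y' ▷ X) ▷ X' ⊗≫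
          ((β_ X X').hom ≫ ε_ X X') := by
      rw [whisker_exchange]
      monoidal
    _ = _ := by
      rw [braiding_whiskerRight_comp_evaluation]
      monoidal

theorem doubleBraiding_tensor (A X Y : C) :
    doubleBraiding A (X ⊗ Y) = (α_ A X Y).inv ≫ (β_ A X).hom ▷ Y ≫ ((α_ X A Y).hom ≫
      X ◁ doubleBraiding A Y ≫ (α_ X A Y).inv) ≫ (β_ X A).hom ▷ Y ≫ (α_ A X Y).hom := by
  simp [doubleBraiding, BraidedCategory.braiding_tensor_left_hom,
    BraidedCategory.braiding_tensor_right_hom]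

theorem doubleBraiding_naturality_left {A B : C} (f : A ⟶ B) (X : C) :
    doubleBraiding A X ≫ f ▷ X = f ▷ X ≫ doubleBraiding B X := by
  simp [doubleBraiding]

theorem doubleBraiding_naturality_right (A : C) {X Y : C} (f : X ⟶ Y) :
    doubleBraiding A X ≫ A ◁ f = A ◁ f ≫ doubleBraiding A Y := by
  simp [doubleBraiding]

end Braided

/-! ### Partial traces in a ribbon category. -/

section PartialTrace

variable {C : Type u} [Category.{v} C] [MonoidalCategory C]

theorem exists_mate {X X' Y Y' : C} [ExactPairing X X'] [ExactPairing Y Y'] (f : Y ⟶ X) :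
    ∃ f' : X' ⟶ Y', η_ X X' ≫ X ◁ f' = η_ Y Y' ≫ f ▷ Y' ∧
      f' ▷ Y ≫ ε_ Y Y' = X' ◁ f ≫ ε_ X X' :=
  letI : HasRightDual X := ⟨X'⟩
  letI : HasRightDual Y := ⟨Y'⟩
  ⟨rightAdjointMate f, coevaluation_comp_rightAdjointMate f, rightAdjointMate_comp_evaluation f⟩

variable [BraidedCategory C] [RightRigidCategory C] [RibbonCategory C]

/-- The right evaluation `X ⊗ X' ⟶ 𝟙` determined by an arbitrary dual `X'` of `X`. -/
def rightEvOf (X X' : C) [ExactPairing X X'] : X ⊗ X' ⟶ 𝟙_ C :=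
  (RibbonCategory.twist X).hom ▷ X' ≫ (β_ X X').hom ≫ ε_ X X'

/-- The partial trace over the right tensor factor, computed with the dual `X'` of `X`. -/
def partialTrace (X X' : C) [ExactPairing X X'] {A B : C} (g : A ⊗ X ⟶ B ⊗ X) : A ⟶ B :=
  (ρ_ A).inv ≫ A ◁ η_ X X' ≫ (α_ A X X').inv ≫ g ▷ X' ≫ (α_ B X X').hom ≫
    B ◁ rightEvOf X X' ≫ (ρ_ B).hom

theorem partialTrace_cyclic {X X' Y Y' : C} [ExactPairing X X'] [ExactPairing Y Y'] {A B : C}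
    (g : A ⊗ X ⟶ B ⊗ Y) (h : Y ⟶ X) :
    partialTrace X X' (g ≫ B ◁ h) = partialTrace Y Y' (A ◁ h ≫ g) := by
  obtain ⟨h', h₁, h₂⟩ := exists_mate (X' := X') (Y' := Y') h
  have h₃ : Y ◁ h' ≫ rightEvOf Y Y' = h ▷ X' ≫ rightEvOf X X' := by
    simp only [rightEvOf]
    rw [whisker_exchange_assoc, BraidedCategory.braiding_naturality_right_assoc, h₂,
      ← BraidedCategory.braiding_naturality_left_assoc, ← comp_whiskerRight_assoc,
      ← RibbonCategory.twist_naturality, comp_whiskerRight_assoc]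
  calc
    _ = (ρ_ A).inv ≫ A ◁ η_ X X' ≫ (α_ A X X').inv ≫ g ▷ X' ≫ (α_ B Y X').hom ≫
          B ◁ (h ▷ X' ≫ rightEvOf X X') ≫ (ρ_ B).hom := by
      simp [partialTrace]
    _ = (ρ_ A).inv ≫ A ◁ (η_ X X' ≫ X ◁ h') ≫ (α_ A X Y').inv ≫ g ▷ Y' ≫ (α_ B Y Y').hom ≫
          B ◁ (rightEvOf Y Y') ≫ (ρ_ B).hom := by
      rw [← h₃]
      simp only [MonoidalCategory.whiskerLeft_comp, Category.assoc]
      rw [associator_inv_naturality_right_assoc, whisker_exchange_assoc,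
        associator_naturality_right_assoc]
    _ = _ := by
      rw [h₁]
      simp [partialTrace]

/-- Independence of the dual allows `Y' ⊗ X'` to serve as the dual of `X ⊗ Y` in place of the chosen
one. -/
theorem partialTrace_eq {X X' X'' : C} [ExactPairing X X'] [ExactPairing X X''] {A B : C}
    (g : A ⊗ X ⟶ B ⊗ X) : partialTrace X X' g = partialTrace X X'' g := by
  simpa using partialTrace_cyclic (X' := X') (Y' := X'') g (𝟙 X)

theorem trace_eq_partialTrace {X : C} (X' : C) [ExactPairing X X'] (f : X ⟶ X) :
    trace f = partialTrace X X' (𝟙_ C ◁ f) := by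
  rw [partialTrace_eq (X'' := Xᘁ)]
  change η_ X Xᘁ ≫ f ▷ Xᘁ ≫ rightEvOf X Xᘁ = _
  simp only [partialTrace]
  monoidal

theorem trace_eq {X : C} (X' : C) [ExactPairing X X'] (f : X ⟶ X) :
    trace f = η_ X X' ≫ f ▷ X' ≫ rightEvOf X X' := by
  rw [trace_eq_partialTrace X']
  simp only [partialTrace]
  monoidal

theorem partialTrace_naturality {X X' A A' B B' : C} [ExactPairing X X'] (a : A' ⟶ A)
    (g : A ⊗ X ⟶ B ⊗ X) (b : B ⟶ B') :
    partialTrace X X' (a ▷ X ≫ g ≫ b ▷ X) = a ≫ partialTrace X X' g ≫ b := by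
  simp only [partialTrace, comp_whiskerRight, Category.assoc]
  rw [← associator_inv_naturality_left_assoc, whisker_exchange_assoc,
    ← rightUnitor_inv_naturality_assoc, associator_naturality_left_assoc,
    ← whisker_exchange_assoc, rightUnitor_naturality]

theorem whiskerLeft_partialTrace {X X' A B : C} [ExactPairing X X'] (Z : C)
    (g : A ⊗ X ⟶ B ⊗ X) :
    partialTrace X X' ((α_ Z A X).hom ≫ Z ◁ g ≫ (α_ Z B X).inv) = Z ◁ partialTrace X X' g := by
  simp only [partialTrace]
  monoidal

theorem partialTrace_whiskerLeft {X : C} (X' : C) [ExactPairing X X'] (A : C) (f : X ⟶ X) :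
    partialTrace X X' (A ◁ f) = (ρ_ A).inv ≫ A ◁ trace f ≫ (ρ_ A).hom := by
  rw [trace_eq X']
  simp only [partialTrace]
  monoidal

/-- The double braiding in the twist of `X ⊗ Y` is exactly what unlinks the two caps. -/
theorem rightEvOf_tensor (X X' Y Y' : C) [ExactPairing X X'] [ExactPairing Y Y'] :
    rightEvOf (X ⊗ Y) (Y' ⊗ X') = 𝟙 _ ⊗≫ X ◁ rightEvOf Y Y' ▷ X' ⊗≫ rightEvOf X X' := by
  have h : rightEvOf (X ⊗ Y) (Y' ⊗ X') =
      ((RibbonCategory.twist X).hom ⊗ₘ (RibbonCategory.twist Y).hom) ▷ (Y' ⊗ X') ≫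
        doubleBraiding X Y ▷ (Y' ⊗ X') ≫ (β_ (X ⊗ Y) (Y' ⊗ X')).hom ≫
          ε_ (X ⊗ Y) (Y' ⊗ X') := by
    simp only [rightEvOf, doubleBraiding, RibbonCategory.twist_tensor, comp_whiskerRight,
      Category.assoc]
  rw [h, doubleBraiding_comp_braiding_comp_evaluation, MonoidalCategory.tensorHom_def]
  calc
    _ = 𝟙 _ ⊗≫ ((RibbonCategory.twist X).hom ▷ (Y ⊗ Y') ≫
          X ◁ ((RibbonCategory.twist Y).hom ▷ Y' ≫ (β_ Y Y').hom ≫ ε_ Y Y')) ▷ X' ⊗≫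
            ((β_ X X').hom ≫ ε_ X X') := by
      monoidal
    _ = _ := by
      rw [← whisker_exchange]
      simp only [rightEvOf]
      monoidal

theorem partialTrace_tensor {X X' Y Y' : C} [ExactPairing X X'] [ExactPairing Y Y'] {A B : C}
    (g : A ⊗ (X ⊗ Y) ⟶ B ⊗ (X ⊗ Y)) :
    partialTrace (X ⊗ Y) (Y' ⊗ X') g =
      partialTrace X X' (partialTrace Y Y' ((α_ A X Y).hom ≫ g ≫ (α_ B X Y).inv)) := by
  simp only [partialTrace]
  rw [rightEvOf_tensor, ExactPairing.tensor_coevaluation]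
  monoidal

theorem trace_tensor {X Y : C} (Y' : C) [ExactPairing Y Y'] (f : X ⊗ Y ⟶ X ⊗ Y) :
    trace f = trace (partialTrace Y Y' f) := by
  rw [trace_eq (Y' ⊗ Xᘁ), trace_eq Xᘁ]
  simp only [partialTrace]
  rw [rightEvOf_tensor, ExactPairing.tensor_coevaluation]
  monoidal

theorem partialTrace_doubleBraiding_tensor {X X' Y Y' : C} [ExactPairing X X'] [ExactPairing Y Y']
    (A : C) :
    partialTrace (X ⊗ Y) (Y' ⊗ X') (doubleBraiding A (X ⊗ Y)) =
      partialTrace X X' ((β_ A X).hom ≫ X ◁ partialTrace Y Y' (doubleBraiding A Y) ≫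
        (β_ X A).hom) := by
  rw [partialTrace_tensor, ← whiskerLeft_partialTrace, ← partialTrace_naturality,
    doubleBraiding_tensor]
  simp

/-- With the braided pairing making `X` a dual of `Xᘁ`, the two loops differ only in whether the
twist sits on `X` or on `Xᘁ`; `twist_coev` exchanges these. -/
theorem trace_id_dual (X : C) : trace (𝟙 Xᘁ) = trace (𝟙 X) := by
  let := BraidedCategory.exactPairing_swap X Xᘁ
  rw [trace_eq X, trace_eq Xᘁ]
  have h₁ : η_ Xᘁ X = η_ X Xᘁ ≫ (β_ Xᘁ X).inv := rfl
  have h₂ : ε_ Xᘁ X = (β_ X Xᘁ).hom ≫ ε_ X Xᘁ := rfl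
  simp only [rightEvOf, h₁, h₂, id_whiskerRight, Category.id_comp, Category.assoc]
  rw [BraidedCategory.braiding_naturality_left_assoc, Iso.inv_hom_id_assoc,
    ← reassoc_of% (RibbonCategory.twist_coev X)]

end PartialTrace

/-! ### Gauss sums as pure matrix algebra. -/

section GaussSums

variable {k I : Type*} [Field k] [Fintype I]

theorem gaussSum_mul_dim {S : Matrix I I k} {θ d : I → k} {N : I → I → I → k}
    (hS : ∀ i j, θ i * θ j * S i j = ∑ l, N i j l * (θ l * d l))
    (hN : ∀ i j, ∑ l, N l i j * d l = d j * d i) (i : I) :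
    θ i * ∑ l, θ l * d l * S l i = (∑ l, d l * θ l * d l) * d i := by
  calc
    _ = ∑ l, d l * (θ l * θ i * S l i) := by
      rw [Finset.mul_sum]
      exact Finset.sum_congr rfl fun l _ => by ring
    _ = ∑ j, ∑ l, N l i j * d l * (θ j * d j) := by
      simp only [hS, Finset.mul_sum]
      rw [Finset.sum_comm]
      exact Finset.sum_congr rfl fun j _ => Finset.sum_congr rfl fun l _ => by ring
    _ = ∑ j, d j * d i * (θ j * d j) := by
      simp only [← Finset.sum_mul, hN]
    _ = _ := by
      rw [Finset.sum_mul]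
      exact Finset.sum_congr rfl fun j _ => by ring

variable [DecidableEq I] [Nonempty I] {S : Matrix I I k} {θ d : I → k} {N : I → I → I → k}

theorem gaussSum_ne_zero (hdet : S.det ≠ 0) (hθ : ∀ i, θ i ≠ 0) (hd : ∀ i, d i ≠ 0)
    (hS : ∀ i j, θ i * θ j * S i j = ∑ l, N i j l * (θ l * d l))
    (hN : ∀ i j, ∑ l, N l i j * d l = d j * d i) :
    ∑ l, d l * θ l * d l ≠ 0 := by
  intro h
  have h₁ : Matrix.vecMul (fun l => θ l * d l) S = 0 := by
    ext i
    have := gaussSum_mul_dim hS hN i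
    rw [h, zero_mul] at this
    exact (mul_eq_zero.mp this).resolve_left (hθ i)
  have h₂ := Matrix.eq_zero_of_vecMul_eq_zero hdet h₁
  obtain ⟨i⟩ := ‹Nonempty I›
  exact mul_ne_zero (hθ i) (hd i) (congrFun h₂ i)

theorem inverse_gaussSum_ne_zero {χ : I → I → k} (hdet : S.det ≠ 0) (hθ : ∀ i, θ i ≠ 0)
    (hd : ∀ i, d i ≠ 0) (hS : ∀ i j, θ i * θ j * S i j = ∑ l, N i j l * (θ l * d l))
    (hN : ∀ i j, ∑ l, N l i j * d l = d j * d i)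
    (hχ : ∀ i j, S i j = χ i j * d i)
    (hmul : ∀ l i j, χ l i * χ l j = ∑ m, N i j m * χ l m) :
    ∑ l, d l * (θ l)⁻¹ * d l ≠ 0 := by
  intro h
  set b := ∑ l, d l * θ l * d l with hb
  have h₀ : ∀ i, ∑ l, θ l * d l * S l i = b * (θ i)⁻¹ * d i := fun i => by
    have := gaussSum_mul_dim hS hN i
    field_simp [hθ i]
    rw [← this]
    ring
  -- Multiplicativity of the characters `χ l` turns the double sum into Gauss sums, and the result
  -- is a multiple of the sum assumed zero in `h`.
  have h₁ : Matrix.vecMul (fun l => θ l * ∑ i, S l i * d i) S = 0 := by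
    ext j
    calc
      _ = ∑ l, ∑ i, d i * (θ l * d l * d l * (χ l i * χ l j)) := by
        simp only [Matrix.vecMul, dotProduct, Finset.mul_sum, Finset.sum_mul]
        exact Finset.sum_congr rfl fun l _ => Finset.sum_congr rfl fun i _ => by
          rw [hχ l i, hχ l j]
          ring
      _ = ∑ i, ∑ m, N i j m * d i * ∑ l, θ l * d l * S l m := by
        rw [Finset.sum_comm]
        refine Finset.sum_congr rfl fun i _ => ?_
        simp only [hmul, Finset.mul_sum]
        rw [Finset.sum_comm]
        exact Finset.sum_congr rfl fun m _ => Finset.sum_congr rfl fun l _ => by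
          rw [hχ l m]
          ring
      _ = ∑ m, (∑ i, N i j m * d i) * (b * (θ m)⁻¹ * d m) := by
        simp only [h₀]
        rw [Finset.sum_comm]
        simp only [Finset.sum_mul]
      _ = b * d j * ∑ m, d m * (θ m)⁻¹ * d m := by
        rw [Finset.mul_sum]
        exact Finset.sum_congr rfl fun m _ => by
          rw [hN]
          ring
      _ = 0 := by rw [h, mul_zero]
  have h₂ := Matrix.eq_zero_of_vecMul_eq_zero hdet h₁
  have h₃ : Matrix.mulVec S d = 0 := by
    ext l
    exact (mul_eq_zero.mp (congrFun h₂ l)).resolve_left (hθ l)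
  obtain ⟨i⟩ := ‹Nonempty I›
  exact hd i (congrFun (Matrix.eq_zero_of_mulVec_eq_zero hdet h₃) i)

end GaussSums

/-! ### Simple objects and Hom dimensions of biproducts. -/

section Linear

variable {k : Type w} [Field k] {C : Type u} [Category.{v} C] [Preadditive C] [Linear k C]

namespace IsSimpleObj

variable {X : C}

theorem scalar_smul_id (hX : IsSimpleObj k X) (c : k) : hX.scalar (c • 𝟙 X) = c := by
  have h : End.of (c • 𝟙 X) = algebraMap k (End X) c := by
    rw [Algebra.algebraMap_eq_smul_one]
    rfl
  rw [scalar, h, AlgEquiv.commutes]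
  rfl

theorem smul_id_injective (hX : IsSimpleObj k X) {a b : k} (h : a • 𝟙 X = b • 𝟙 X) : a = b := by
  rw [← hX.scalar_smul_id a, h, hX.scalar_smul_id]

theorem finrank_end (hX : IsSimpleObj k X) : Module.finrank k (X ⟶ X) = 1 :=
  (LinearEquiv.finrank_eq hX.some.toLinearEquiv).trans (Module.finrank_self k)

theorem scalar_ne_zero (hX : IsSimpleObj k X) (e : X ≅ X) : hX.scalar e.hom ≠ 0 := by
  intro h
  have h₁ : 𝟙 X = 0 := by
    rw [← e.hom_inv_id, ← hX.scalar_smul e.hom, h, zero_smul, zero_comp]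
  have h₂ : (1 : k) • 𝟙 X = (0 : k) • 𝟙 X := by rw [h₁, smul_zero, smul_zero]
  exact one_ne_zero (hX.smul_id_injective h₂)

end IsSimpleObj

variable [HasFiniteBiproducts C]

variable (k) in
/-- Morphisms out of a finite biproduct are families of morphisms. -/
noncomputable def biproductHomEquiv {J : Type*} [Fintype J] (f : J → C) (Z : C) :
    (⨁ f ⟶ Z) ≃ₗ[k] ((j : J) → (f j ⟶ Z)) where
  toFun g j := biproduct.ι f j ≫ g
  map_add' g h := by ext; simp
  map_smul' c g := by ext; simp
  invFun g := biproduct.desc g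
  left_inv g := by ext; simp
  right_inv g := by ext; simp

variable (k) in
/-- Morphisms into a finite biproduct are families of morphisms. -/
noncomputable def homBiproductEquiv {J : Type*} [Fintype J] (f : J → C) (Z : C) :
    (Z ⟶ ⨁ f) ≃ₗ[k] ((j : J) → (Z ⟶ f j)) where
  toFun g j := g ≫ biproduct.π f j
  map_add' g h := by ext; simp
  map_smul' c g := by ext; simp
  invFun g := biproduct.lift g
  left_inv g := by ext; simp
  right_inv g := by ext; simp

variable [IsMultiFusion k C]

instance (X Y : C) : Module.Finite k (X ⟶ Y) := IsMultiFusion.hom_finite X Y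

theorem finrank_biproduct_hom {J : Type*} [Fintype J] (f : J → C) (Z : C) :
    Module.finrank k (⨁ f ⟶ Z) = ∑ j, Module.finrank k (f j ⟶ Z) := by
  rw [(biproductHomEquiv k f Z).finrank_eq, Module.finrank_pi_fintype]

theorem finrank_hom_biproduct {J : Type*} [Fintype J] (f : J → C) (Z : C) :
    Module.finrank k (Z ⟶ ⨁ f) = ∑ j, Module.finrank k (Z ⟶ f j) := by
  rw [(homBiproductEquiv k f Z).finrank_eq, Module.finrank_pi_fintype]

variable {I : Type*} {V : I → C}

theorem IsSimpleReps.exists_decomposition (hV : IsSimpleReps k V) (X : C) :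
    ∃ (n : ℕ) (j : Fin n → I), Nonempty (X ≅ ⨁ fun a => V (j a)) := by
  obtain ⟨n, Y, hY, ⟨e⟩⟩ := IsMultiFusion.semisimple (k := k) X
  choose j hj using fun a => hV.exists_iso (Y a) (hY a)
  exact ⟨n, j, ⟨e ≪≫ biproduct.mapIso fun a => (hj a).some⟩⟩

end Linear

/-! ### Linearity of traces. -/

section LinearTrace

variable {C : Type u} [Category.{v} C] [MonoidalCategory C] [Preadditive C]
  [MonoidalPreadditive C] [BraidedCategory C] [RightRigidCategory C] [RibbonCategory C]

theorem partialTrace_sum {X X' A B : C} [ExactPairing X X'] {J : Type*} (s : Finset J)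
    (g : J → (A ⊗ X ⟶ B ⊗ X)) :
    partialTrace X X' (∑ j ∈ s, g j) = ∑ j ∈ s, partialTrace X X' (g j) := by
  simp [partialTrace, sum_whiskerRight, Preadditive.comp_sum, Preadditive.sum_comp]

theorem partialTrace_smul {k : Type w} [Field k] [Linear k C] [MonoidalLinear k C]
    {X X' A B : C} [ExactPairing X X'] (c : k) (g : A ⊗ X ⟶ B ⊗ X) :
    partialTrace X X' (c • g) = c • partialTrace X X' g := by
  simp [partialTrace]

theorem trace_smul {k : Type w} [Field k] [Linear k C] [MonoidalLinear k C]
    {X : C} (c : k) (f : X ⟶ X) : trace (c • f) = c • trace f := by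
  simp [trace]

end LinearTrace

/-! ### Multiplicities and traces over simple summands. -/

section Semisimple

variable {k : Type w} [Field k] {C : Type u} [Category.{v} C] [Preadditive C] [Linear k C]
  {I : Type*} [DecidableEq I] {V : I → C}

theorem IsSimpleReps.finrank_hom (hV : IsSimpleReps k V)
    (hV₀ : ∀ i j, i ≠ j → ∀ f : V i ⟶ V j, f = 0) (i j : I) :
    Module.finrank k (V i ⟶ V j) = if i = j then 1 else 0 := by
  split_ifs with h
  · subst h
    exact (hV.simple i).finrank_end
  · have : Subsingleton (V i ⟶ V j) := ⟨fun f g => (hV₀ i j h f).trans (hV₀ i j h g).symm⟩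
    exact Module.finrank_zero_of_subsingleton

variable [HasFiniteBiproducts C] [IsMultiFusion k C]

theorem IsSimpleReps.finrank_hom_comm (hV : IsSimpleReps k V)
    (hV₀ : ∀ i j, i ≠ j → ∀ f : V i ⟶ V j, f = 0) (X : C) (l : I) :
    Module.finrank k (V l ⟶ X) = Module.finrank k (X ⟶ V l) := by
  obtain ⟨n, j, ⟨e⟩⟩ := hV.exists_decomposition X
  rw [(Linear.homCongr k e (Iso.refl (V l))).finrank_eq,
    (Linear.homCongr k (Iso.refl (V l)) e).finrank_eq, finrank_biproduct_hom,
    finrank_hom_biproduct]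
  simp only [hV.finrank_hom hV₀, eq_comm]

theorem IsSimpleReps.multiplicity_eq_one [Fintype I] (hV : IsSimpleReps k V)
    (hV₀ : ∀ i j, i ≠ j → ∀ f : V i ⟶ V j, f = 0) (m : I → ℕ)
    (e : (⨁ fun j => ⨁ fun _ : Fin (m j) => V j) ≅ ⨁ V) (i : I) : m i = 1 := by
  have h := (Linear.homCongr k e (Iso.refl (V i))).finrank_eq
  rw [finrank_biproduct_hom, finrank_biproduct_hom] at h
  simpa [finrank_biproduct_hom, hV.finrank_hom hV₀] using h

/-- Insert the decomposition of `𝟙 X` and cycle each inclusion round the loop; naturality of `g`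
then brings it next to its projection, where they cancel. This serves the double braiding, the twist
and the identity alike. -/
theorem IsSimpleReps.partialTrace_eq_sum [MonoidalCategory C] [MonoidalPreadditive C]
    [BraidedCategory C] [RightRigidCategory C] [RibbonCategory C] [Fintype I]
    (hV : IsSimpleReps k V) (hV₀ : ∀ i j, i ≠ j → ∀ f : V i ⟶ V j, f = 0) {A : C}
    (g : ∀ X : C, A ⊗ X ⟶ A ⊗ X)
    (hg : ∀ {X Y : C} (f : X ⟶ Y), g X ≫ A ◁ f = A ◁ f ≫ g Y) (X : C) :
    partialTrace X Xᘁ (g X) =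
      ∑ l, Module.finrank k (X ⟶ V l) • partialTrace (V l) (V l)ᘁ (g (V l)) := by
  obtain ⟨n, j, ⟨e⟩⟩ := hV.exists_decomposition X
  have h₁ : ∀ l, Module.finrank k (X ⟶ V l) = ∑ a, if j a = l then 1 else 0 := fun l => by
    rw [(Linear.homCongr k e (Iso.refl (V l))).finrank_eq, finrank_biproduct_hom]
    simp only [hV.finrank_hom hV₀]
  have h₂ : ∑ a, (e.hom ≫ biproduct.π _ a) ≫ (biproduct.ι (fun a => V (j a)) a ≫ e.inv) = 𝟙 X := by
    have := congrArg (fun t => e.hom ≫ t ≫ e.inv) (biproduct.total (f := fun a => V (j a)))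
    rw [Preadditive.sum_comp, Preadditive.comp_sum, Category.id_comp, e.hom_inv_id] at this
    simpa only [Category.assoc] using this
  calc
    _ = ∑ a, partialTrace (V (j a)) (V (j a))ᘁ (g (V (j a))) := by
      rw [← Category.comp_id (g X), ← MonoidalCategory.whiskerLeft_id, ← h₂, whiskerLeft_sum,
        Preadditive.comp_sum, partialTrace_sum]
      refine Finset.sum_congr rfl fun a _ => ?_
      rw [MonoidalCategory.whiskerLeft_comp, ← Category.assoc,
        partialTrace_cyclic (Y' := (V (j a))ᘁ), hg, ← Category.assoc,
        ← MonoidalCategory.whiskerLeft_comp]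
      simp
    _ = _ := by
      simp only [h₁, Finset.sum_smul]
      rw [Finset.sum_comm]
      simp

end Semisimple

/-! ### Encircling scalars, balancing and Schur's lemma. -/

section Fusion

variable {k : Type w} [Field k] {C : Type u} [Category.{v} C] [MonoidalCategory C]
  [Preadditive C] [Linear k C]

section

variable [BraidedCategory C] [RightRigidCategory C] [RibbonCategory C]

/-- The scalar by which a loop coloured by `X` encircling the simple object `A` acts. -/
noncomputable def encircling {A : C} (hA : IsSimpleObj k A) (X : C) : k :=
  hA.scalar (partialTrace X Xᘁ (doubleBraiding A X))

theorem encircling_smul_id {A : C} (hA : IsSimpleObj k A) (X X' : C) [ExactPairing X X'] :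
    partialTrace X X' (doubleBraiding A X) = encircling hA X • 𝟙 A := by
  rw [encircling, IsSimpleObj.scalar_smul]
  exact partialTrace_eq _

/-- The loop slides along `f`, so both scalars multiply `f` equally. -/
theorem encircling_eq_of_ne_zero {A B : C} (hA : IsSimpleObj k A) (hB : IsSimpleObj k B)
    {f : A ⟶ B} (hf : f ≠ 0) (X : C) : encircling hA X = encircling hB X := by
  have h : partialTrace X Xᘁ (doubleBraiding A X) ≫ f =
      f ≫ partialTrace X Xᘁ (doubleBraiding B X) := by
    have h₁ := partialTrace_naturality (X' := Xᘁ) (𝟙 A) (doubleBraiding A X) f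
    have h₂ := partialTrace_naturality (X' := Xᘁ) f (doubleBraiding B X) (𝟙 B)
    rw [doubleBraiding_naturality_left] at h₁
    simp only [id_whiskerRight, Category.id_comp, Category.comp_id] at h₁ h₂
    rw [← h₁, h₂]
  rw [encircling_smul_id hA, encircling_smul_id hB, Linear.smul_comp, Linear.comp_smul,
    Category.id_comp, Category.comp_id, ← sub_eq_zero, ← sub_smul] at h
  exact sub_eq_zero.mp ((smul_eq_zero.mp h).resolve_right hf)

variable [MonoidalPreadditive C] [MonoidalLinear k C]

/-- A loop coloured by `X ⊗ Y` is a pair of parallel loops, and the inner one acts on `A` by a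
scalar. -/
theorem encircling_tensor {A : C} (hA : IsSimpleObj k A) (X Y : C) :
    encircling hA X * encircling hA Y = encircling hA (X ⊗ Y) := by
  apply hA.smul_id_injective
  rw [← encircling_smul_id hA (X ⊗ Y) (Yᘁ ⊗ Xᘁ), partialTrace_doubleBraiding_tensor,
    encircling_smul_id hA Y, MonoidalLinear.whiskerLeft_smul, MonoidalCategory.whiskerLeft_id,
    Linear.smul_comp, Category.id_comp, Linear.comp_smul, partialTrace_smul]
  change _ = encircling hA Y • partialTrace X Xᘁ (doubleBraiding A X)
  rw [encircling_smul_id hA X, smul_smul, mul_comm]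

end

section

variable [HasFiniteBiproducts C] [BraidedCategory C] [RightRigidCategory C] [RibbonCategory C]
  [IsFusion k C]

theorem scalarTrace_smul_id {X : C} (f : X ⟶ X) : scalarTrace k f • 𝟙 (𝟙_ C) = trace f :=
  IsSimpleObj.scalar_smul _ _

theorem scalarTrace_eq {X : C} {f : X ⟶ X} {c : k} (h : trace f = c • 𝟙 (𝟙_ C)) :
    scalarTrace k f = c := by
  rw [scalarTrace, h, IsSimpleObj.scalar_smul_id]

theorem dim_dual (X : C) : dim k Xᘁ = dim k X :=
  scalarTrace_eq (by rw [trace_id_dual, ← scalarTrace_smul_id (k := k) (𝟙 X)]; rfl)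

end

variable [MonoidalPreadditive C] [MonoidalLinear k C]

variable (k) in
/-- Tensoring with an object is left adjoint to tensoring with its dual, `k`-linearly. -/
def tensorRightHomLinearEquiv (X Y Y' Z : C) [ExactPairing Y Y'] :
    (X ⊗ Y ⟶ Z) ≃ₗ[k] (X ⟶ Z ⊗ Y') where
  __ := tensorRightHomEquiv X Y Y' Z
  map_add' f g := by simp [tensorRightHomEquiv]
  map_smul' c f := by simp [tensorRightHomEquiv]

variable [HasFiniteBiproducts C] [BraidedCategory C]
  [RightRigidCategory C] [RibbonCategory C] [IsFusion k C]

theorem scalarTrace_smul {X : C} (c : k) (f : X ⟶ X) :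
    scalarTrace k (c • f) = c * scalarTrace k f :=
  scalarTrace_eq (by rw [trace_smul, ← scalarTrace_smul_id (k := k) f, smul_smul])

theorem partialTrace_whiskerLeft_smul {X : C} (X' : C) [ExactPairing X X'] (A : C) (f : X ⟶ X) :
    partialTrace X X' (A ◁ f) = scalarTrace k f • 𝟙 A := by
  rw [partialTrace_whiskerLeft, ← scalarTrace_smul_id (k := k) f]
  simp

theorem scalarTrace_tensor {X Y : C} (f : X ⊗ Y ⟶ X ⊗ Y) {c : k}
    (h : partialTrace Y Yᘁ f = c • 𝟙 X) : scalarTrace k f = c * dim k X := by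
  refine scalarTrace_eq ?_
  rw [trace_tensor Yᘁ, h, trace_smul, ← scalarTrace_smul_id (k := k) (𝟙 X), smul_smul]
  rfl

theorem dim_tensor (X Y : C) : dim k (X ⊗ Y) = dim k X * dim k Y := by
  rw [dim, scalarTrace_tensor (k := k) (𝟙 (X ⊗ Y)) (c := dim k Y), mul_comm]
  rw [← MonoidalCategory.whiskerLeft_id, partialTrace_whiskerLeft_smul (k := k)]
  rfl

theorem scalarTrace_doubleBraiding {A : C} (hA : IsSimpleObj k A) (X : C) :
    scalarTrace k (doubleBraiding A X) = encircling hA X * dim k A :=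
  scalarTrace_tensor _ (encircling_smul_id hA X Xᘁ)

theorem twistEigenvalue_mul_mul_scalarTrace {X Y : C} (hX : IsSimpleObj k X)
    (hY : IsSimpleObj k Y) :
    twistEigenvalue hX * twistEigenvalue hY * scalarTrace k (doubleBraiding X Y) =
      scalarTrace k (RibbonCategory.twist (X ⊗ Y)).hom := by
  rw [RibbonCategory.twist_tensor, ← hX.scalar_smul (RibbonCategory.twist X).hom,
    ← hY.scalar_smul (RibbonCategory.twist Y).hom, ← scalarTrace_smul]
  simp [MonoidalCategory.tensorHom_def, twistEigenvalue, doubleBraiding, smul_smul, mul_comm]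

theorem scalarTrace_twist {X : C} (hX : IsSimpleObj k X) :
    scalarTrace k (RibbonCategory.twist X).hom = twistEigenvalue hX * dim k X := by
  rw [← hX.scalar_smul (RibbonCategory.twist X).hom, scalarTrace_smul]
  rfl

variable {I : Type*} {V : I → C}

theorem IsSimpleReps.sMatrix_apply (hV : IsSimpleReps k V) (i j : I) :
    sMatrix k V i j = encircling (hV.simple i) (V j) * dim k (V i) :=
  scalarTrace_doubleBraiding _ _

variable [Fintype I] [DecidableEq I]

theorem IsSimpleReps.dim_ne_zero (hV : IsSimpleReps k V) (hS : (sMatrix k V).det ≠ 0) (i : I) :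
    dim k (V i) ≠ 0 := fun h =>
  hS (Matrix.det_eq_zero_of_row_eq_zero i fun j => by rw [hV.sMatrix_apply, h, mul_zero])

theorem IsSimpleReps.hom_eq_zero (hV : IsSimpleReps k V) (hS : (sMatrix k V).det ≠ 0)
    (i j : I) (hij : i ≠ j) (f : V i ⟶ V j) : f = 0 := by
  by_contra hf
  -- A nonzero `f` makes the encircling scalars of `V i` and `V j` agree, so rows `i` and `j` of S
  -- are proportional with factors `dim k (V i)` and `dim k (V j)`.
  have h : Matrix.vecMul (Pi.single i (dim k (V j)) - Pi.single j (dim k (V i)))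
      (sMatrix k V) = 0 := by
    ext l
    rw [Matrix.sub_vecMul, Matrix.single_vecMul, Matrix.single_vecMul]
    simp only [Matrix.row, Pi.sub_apply, Pi.smul_apply, smul_eq_mul, Pi.zero_apply]
    rw [hV.sMatrix_apply, hV.sMatrix_apply,
      encircling_eq_of_ne_zero (hV.simple i) (hV.simple j) hf]
    ring
  have h₁ := congrFun (Matrix.eq_zero_of_vecMul_eq_zero hS h) i
  simp only [Pi.sub_apply, Pi.single_eq_same, Pi.single_eq_of_ne hij, sub_zero] at h₁
  exact hV.dim_ne_zero hS j h₁

theorem IsSimpleReps.encircling_eq_sum (hV : IsSimpleReps k V)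
    (hV₀ : ∀ i j, i ≠ j → ∀ f : V i ⟶ V j, f = 0) {A : C} (hA : IsSimpleObj k A) (X : C) :
    encircling hA X = ∑ l, (Module.finrank k (X ⟶ V l) : k) * encircling hA (V l) := by
  apply hA.smul_id_injective
  rw [← encircling_smul_id hA X Xᘁ, hV.partialTrace_eq_sum hV₀ (doubleBraiding A)
    (doubleBraiding_naturality_right A), Finset.sum_smul]
  refine Finset.sum_congr rfl fun l _ => ?_
  rw [encircling_smul_id hA, mul_smul, Nat.cast_smul_eq_nsmul]

theorem IsSimpleReps.scalarTrace_eq_sum (hV : IsSimpleReps k V)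
    (hV₀ : ∀ i j, i ≠ j → ∀ f : V i ⟶ V j, f = 0) (g : ∀ X : C, X ⟶ X)
    (hg : ∀ {X Y : C} (f : X ⟶ Y), g X ≫ f = f ≫ g Y) (X : C) :
    scalarTrace k (g X) = ∑ l, (Module.finrank k (X ⟶ V l) : k) * scalarTrace k (g (V l)) := by
  apply (IsFusion.unit_simple (k := k) (C := C)).smul_id_injective
  rw [← partialTrace_whiskerLeft_smul Xᘁ, hV.partialTrace_eq_sum hV₀ (fun X => 𝟙_ C ◁ g X)
    (fun f => by rw [← MonoidalCategory.whiskerLeft_comp, hg, MonoidalCategory.whiskerLeft_comp]),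
    Finset.sum_smul]
  refine Finset.sum_congr rfl fun l _ => ?_
  rw [partialTrace_whiskerLeft_smul (k := k), mul_smul, Nat.cast_smul_eq_nsmul]

/-- Decompose `Y ⊗ Xᘁ` into simples; its multiplicities are read off by moving `Xᘁ` across the Hom
as `X`. -/
theorem IsSimpleReps.sum_finrank_mul_dim (hV : IsSimpleReps k V)
    (hV₀ : ∀ i j, i ≠ j → ∀ f : V i ⟶ V j, f = 0) (X Y : C) :
    ∑ l, (Module.finrank k (V l ⊗ X ⟶ Y) : k) * dim k (V l) = dim k Y * dim k X := by
  rw [← dim_dual X, ← dim_tensor, dim, hV.scalarTrace_eq_sum hV₀ (fun X => 𝟙 X) (by simp)]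
  refine Finset.sum_congr rfl fun l _ => ?_
  rw [(tensorRightHomLinearEquiv k (V l) X Xᘁ Y).finrank_eq, hV.finrank_hom_comm hV₀]
  rfl

end Fusion

theorem IsSimpleReps.det_sMatrix_ne_zero {k : Type w} [Field k] {C : Type u} [Category.{v} C]
    [MonoidalCategory C] [Preadditive C] [Linear k C] [HasFiniteBiproducts C] [BraidedCategory C]
    [RightRigidCategory C] [RibbonCategory C] [IsModular k C] {I : Type*} [Fintype I]
    [DecidableEq I] {V : I → C} (hV : IsSimpleReps k V) : (sMatrix k V).det ≠ 0 := by
  let e := (Fintype.equivFin I).symm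
  have he : IsSimpleReps k (V ∘ e) :=
    ⟨fun j => hV.simple (e j), fun i j h => e.injective (hV.eq_of_iso _ _ h), fun X hX => by
      obtain ⟨j, hj⟩ := hV.exists_iso X hX
      exact ⟨e.symm j, by simpa using hj⟩⟩
  have h := IsModular.nondegenerate _ _ he
  rwa [show sMatrix k (V ∘ e) = (sMatrix k V).submatrix e e from rfl,
    Matrix.det_submatrix_equiv_self] at h

end RT

theorem mainTheorem8 {k : Type w} [Field k] {C : Type u} [Category.{v} C] [MonoidalCategory C]
    [Preadditive C] [Linear k C] [MonoidalPreadditive C] [MonoidalLinear k C]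
    [HasFiniteBiproducts C] [BraidedCategory C] [RightRigidCategory C] [RT.RibbonCategory C]
    [RT.IsModular k C]
    {I : Type*} [Fintype I] (V : I → C) (hV : RT.IsSimpleReps k V)
    (c : I → k) (hc : ∀ j, c j = RT.dim k (V j))
    (m : I → ℕ) (hm : Nonempty ((⨁ fun j => ⨁ fun _ : Fin (m j) => V j) ≅ ⨁ V)) :
    RT.alpha hV c m ≠ 0 ∧ RT.beta hV c m ≠ 0 := by
  classical
  have hdet := hV.det_sMatrix_ne_zero
  have hV₀ := hV.hom_eq_zero hdet
  have hm₁ := hV.multiplicity_eq_one hV₀ m hm.some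
  -- The unit is simple, hence represented in `V`.
  have : Nonempty I := (hV.exists_iso _ (RT.IsFusion.unit_simple (k := k) (C := C))).nonempty
  have hθ : ∀ i, RT.twistEigenvalue (hV.simple i) ≠ 0 := fun i =>
    (hV.simple i).scalar_ne_zero (RT.RibbonCategory.twist (V i))
  have hd := hV.dim_ne_zero hdet
  have hS : ∀ i j, RT.twistEigenvalue (hV.simple i) * RT.twistEigenvalue (hV.simple j) *
      RT.sMatrix k V i j = ∑ l, (Module.finrank k (V i ⊗ V j ⟶ V l) : k) *
        (RT.twistEigenvalue (hV.simple l) * RT.dim k (V l)) := fun i j => by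
    simp only [← RT.scalarTrace_twist (hV.simple _)]
    rw [← hV.scalarTrace_eq_sum hV₀ (fun X => (RT.RibbonCategory.twist X).hom)
      (fun f => (RT.RibbonCategory.twist_naturality f).symm)]
    exact RT.twistEigenvalue_mul_mul_scalarTrace (hV.simple i) (hV.simple j)
  have hN : ∀ i j, ∑ l, (Module.finrank k (V l ⊗ V i ⟶ V j) : k) * RT.dim k (V l) =
      RT.dim k (V j) * RT.dim k (V i) := fun i j => hV.sum_finrank_mul_dim hV₀ (V i) (V j)
  constructor
  · simpa [RT.alpha, hc, hm₁] using
      RT.inverse_gaussSum_ne_zero hdet hθ hd hS hN hV.sMatrix_apply fun l i j => by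
        rw [RT.encircling_tensor, hV.encircling_eq_sum hV₀]
  · simpa [RT.beta, hc, hm₁] using RT.gaussSum_ne_zero hdet hθ hd hS hN
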